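/- Let $d\ge 1$ and $k\ge 0$ be integers. Let $A\subseteq\mathbb R^d$ be a thin Delone set, that is, every closed ball contains only finitely many points of $A$ and every closed half-space contains at least one point of $A$. Assume that $A$ is generic, that is, no $d+1$ points of $A$ lie on a common hyperplane and no $d+2$ points of $A$ lie on a common $(d-1)$-sphere. A $k$-hefty simplex of $A$ is a (closed) $d$-simplex with vertices in $A$ such that exactly $k$ points of $A$ lie strictly inside its circumscribed sphere. A point $y\notin A$ is called generic with respect to $A$ if $A\cup\{y\}$ is generic. Let $a\in A$. Then the $k$-hefty simplices of $A$ that have $a$ as a vertex cover every sufficiently small neighborhood of $a$ exactly $\binom{d+k-1}{d-1}$ times. That is, there is $\varepsilon>0$ such that, within the open ball of radius $\varepsilon$ around $a$: - every point $y$ that is generic with respect to $A$, and hence (Lebesgue-)almost every point $y$, is contained in exactly $\binom{d+k-1}{d-1}$ of the $k$-hefty simplices of $A$ with vertex $a$; - more precisely, every point $y$ that does not lie on the boundary of any $k$-hefty simplex with vertex $a$ is contained in exactly $\binom{d+k-1}{d-1}$ of them, and every point $y$ on the boundary of such a simplex is contained in more than $\binom{d+k-1}{d-1}$ of them. -/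

import Mathlib

open MeasureTheory

/-- Every closed ball contains only finitely many points of `A`. -/
def LocallyFinitePoints {d : ℕ} (A : Set (EuclideanSpace ℝ (Fin d))) : Prop :=
  ∀ (x : EuclideanSpace ℝ (Fin d)) (R : ℝ), (A ∩ Metric.closedBall x R).Finite

/-- Every closed half-space `{x | c ≤ ⟪u, x⟫}`, `u ≠ 0`, contains a point of `A`. -/
def CoarselyDense {d : ℕ} (A : Set (EuclideanSpace ℝ (Fin d))) : Prop :=
  ∀ (u : EuclideanSpace ℝ (Fin d)) (c : ℝ), u ≠ 0 → ∃ x ∈ A, c ≤ inner ℝ u x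

/-- Thin Delone sets: locally finite and coarsely dense. -/
def IsThinDelone {d : ℕ} (A : Set (EuclideanSpace ℝ (Fin d))) : Prop :=
  LocallyFinitePoints A ∧ CoarselyDense A

/-- No `d + 1` points of `A` lie on a common hyperplane, and no `d + 2` points of `A` lie on a
common `(d - 1)`-sphere. -/
def IsGenericSet {d : ℕ} (A : Set (EuclideanSpace ℝ (Fin d))) : Prop :=
  (∀ s : Finset (EuclideanSpace ℝ (Fin d)), (s : Set (EuclideanSpace ℝ (Fin d))) ⊆ A →
    s.card = d + 1 →
    ¬ ∃ (u : EuclideanSpace ℝ (Fin d)) (c : ℝ), u ≠ 0 ∧ ∀ x ∈ s, inner ℝ u x = c) ∧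
  (∀ s : Finset (EuclideanSpace ℝ (Fin d)), (s : Set (EuclideanSpace ℝ (Fin d))) ⊆ A →
    s.card = d + 2 →
    ¬ ∃ (z : EuclideanSpace ℝ (Fin d)) (r : ℝ), 0 < r ∧
      (s : Set (EuclideanSpace ℝ (Fin d))) ⊆ Metric.sphere z r)

/-- The point `x ∉ A` is generic with respect to `A` if `A ∪ {x}` is generic. -/
def IsGenericWrt {d : ℕ} (A : Set (EuclideanSpace ℝ (Fin d))) (x : EuclideanSpace ℝ (Fin d)) :
    Prop :=
  x ∉ A ∧ IsGenericSet (A ∪ {x})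

/-- `s` is the vertex set of a `k`-hefty simplex of `A`: it consists of `d + 1` affinely
independent points of `A`, and exactly `k` points of `A` lie in the open ball bounded by its
circumscribed sphere (the unique sphere through the `d + 1` points). The simplex itself is the
closed set `convexHull ℝ s`. -/
def IsHeftySimplex {d : ℕ} (k : ℕ) (A : Set (EuclideanSpace ℝ (Fin d)))
    (s : Finset (EuclideanSpace ℝ (Fin d))) : Prop :=
  (s : Set (EuclideanSpace ℝ (Fin d))) ⊆ A ∧ s.card = d + 1 ∧
  AffineIndependent ℝ ((↑) : s → EuclideanSpace ℝ (Fin d)) ∧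
  ∃ (z : EuclideanSpace ℝ (Fin d)) (r : ℝ), 0 < r ∧
    (s : Set (EuclideanSpace ℝ (Fin d))) ⊆ Metric.sphere z r ∧
    (A ∩ Metric.ball z r).encard = k

/-- The `k`-hefty simplices of `A` incident to `a`, i.e. with `a` as a vertex. -/
def heftySimplicesAt {d : ℕ} (k : ℕ) (A : Set (EuclideanSpace ℝ (Fin d)))
    (a : EuclideanSpace ℝ (Fin d)) : Set (Finset (EuclideanSpace ℝ (Fin d))) :=
  {s | IsHeftySimplex k A s ∧ a ∈ s}

/-- The number (possibly infinite) of simplices, given by their vertex sets in `F`, that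
contain the point `y`. -/
noncomputable def coverNumber {d : ℕ} (F : Set (Finset (EuclideanSpace ℝ (Fin d))))
    (y : EuclideanSpace ℝ (Fin d)) : ℕ∞ :=
  {s ∈ F | y ∈ convexHull ℝ (s : Set (EuclideanSpace ℝ (Fin d)))}.encard

/-- `y` lies on the boundary of one of the simplices of the family `F`. -/
def OnBoundaryOf {d : ℕ} (F : Set (Finset (EuclideanSpace ℝ (Fin d))))
    (y : EuclideanSpace ℝ (Fin d)) : Prop :=
  ∃ s ∈ F, y ∈ frontier (convexHull ℝ (s : Set (EuclideanSpace ℝ (Fin d))))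

/-! Fix the vertex `a`. A sphere through `a` is determined by the vector `w` from `a` to its
antipode, and a point `b ≠ a` lies on it, respectively inside it, when `⟪b - a, w⟫` is equal to,
respectively greater than, `‖b - a‖ ^ 2`. Regard `⟪b - a, w⟫ ≤ ‖b - a‖ ^ 2` as a linear constraint
on `w`. The `k`-hefty simplices at `a` then become the `d`-sets of constraints whose common vertex
violates exactly `k` others (`isHeftySimplex_insert_iff`). Close to `a`, a simplex with vertex `a`
contains `y` exactly when `y - a` is in the cone spanned by the vectors `b - a`
(`eventually_mem_convexHull_insert_iff`); by duality this says that the vertex maximizes `⟪y - a,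
w⟫` under the `d` constraints alone.

The cover number at `y` is therefore the number of optimal bases with `k` violations in a linear
program with objective `y - a`. Deleting any `j ≤ k` constraints leaves a program with a unique
optimal basis, since `w = 0` is feasible and the thin Delone property bounds the set of `w` that
violate at most `k` constraints (`CoarselyDense.exists_forall_le_encard`). Assigning to each set
of deleted constraints its optimal basis and double counting gives a triangular system whose only
solution is `choose (d + k - 1) (d - 1)` (`card_bases_of_existsUnique`,
`card_optimalBases_with_violations`).

The count applies to every `y` near `a` for which `y - a` is not spanned by fewer than `d` of the
vectors `b - a`. These `y` include the generic points, and they form a conull and hence dense set.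
As only finitely many closed simplices are involved, the remaining points follow by approximation
(`coverNumber_eq_of_not_onBoundaryOf`, `lt_coverNumber_of_onBoundaryOf`). -/

/-! ### Counting bases by the number of violated constraints -/

open Finset in
theorem Finset.card_filter_powersetCard_superset {ι : Type*} [DecidableEq ι] {X Y : Finset ι}
    (hXY : X ⊆ Y) {j : ℕ} (hj : #X ≤ j) :
    #{J ∈ Y.powersetCard j | X ⊆ J} = (#Y - #X).choose (j - #X) := by
  rw [← card_sdiff_of_subset hXY, ← card_powersetCard]
  refine card_nbij' (· \ X) (X ∪ ·) ?_ ?_ ?_ ?_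
  · intro J hJ
    simp only [coe_filter, mem_powersetCard, Set.mem_ofPred_eq, mem_coe] at hJ ⊢
    exact ⟨sdiff_subset_sdiff hJ.1.1 subset_rfl, by rw [card_sdiff_of_subset hJ.2, hJ.1.2]⟩
  · intro J hJ
    simp only [coe_filter, mem_powersetCard, Set.mem_ofPred_eq, mem_coe] at hJ ⊢
    obtain ⟨h1, h2⟩ := subset_sdiff.1 hJ.1
    exact ⟨⟨union_subset hXY h1, by rw [card_union_of_disjoint h2.symm, hJ.2]; omega⟩,
      subset_union_left⟩
  · intro J hJ
    simp only [coe_filter, mem_powersetCard, Set.mem_ofPred_eq] at hJ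
    exact union_sdiff_of_subset hJ.2
  · intro J hJ
    simp only [mem_powersetCard, mem_coe] at hJ
    exact union_sdiff_cancel_left (subset_sdiff.1 hJ.1).2.symm

open PowerSeries in
/-- The coefficient form of
`(1 - X) ^ (-(p + 1)) * (1 - X) ^ (-(q + 1)) = (1 - X) ^ (-(p + q + 2))`. -/
theorem Nat.sum_add_choose_mul_add_choose (p q j : ℕ) :
    ∑ i ∈ Finset.range (j + 1), (p + i).choose p * (q + (j - i)).choose q =
      (p + q + 1 + j).choose (p + q + 1) := by
  have h := congrArg (fun u : ℤ⟦X⟧ˣ => coeff j (u : ℤ⟦X⟧))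
    (invOneSubPow_add ℤ (p + 1) (q + 1))
  simp only [Units.val_mul, show p + 1 + (q + 1) = (p + q + 1) + 1 by ring,
    invOneSubPow_val_succ_eq_mk_add_choose, coeff_mul, coeff_mk,
    Finset.Nat.sum_antidiagonal_eq_sum_range_succ_mk] at h
  exact_mod_cast h.symm

open Finset in
/-- Double counting for a family `𝓑` of `d`-element bases, where `V B` is the set of constraints
violated by `B`. If deleting any set `J` of at most `K` constraints leaves a unique optimal basis,
that is, a unique `B` avoiding `J` all of whose violations are in `J`, then the number of bases
with exactly `K` violations depends only on `d` and `K`.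

For each `j ≤ K`, sorting the `j`-subsets `J` of `S` by their basis gives `choose n j = ∑ i ≤ j, g
i * choose (n - d - i) (j - i)`, with `n = #S` and `g i` the number of bases with `i` violations.
This system is triangular in `g` and has the stated solution. -/
theorem card_bases_of_existsUnique {ι : Type*} [DecidableEq ι] {d K : ℕ} (hd : 1 ≤ d)
    {S : Finset ι} (hS : K ≤ #S) (𝓑 : Finset (Finset ι)) (V : Finset ι → Finset ι)
    (hB : ∀ B ∈ 𝓑, B ⊆ S ∧ #B = d) (hV : ∀ B ∈ 𝓑, V B ⊆ S \ B)
    (huniq : ∀ J ⊆ S, #J ≤ K → ∃! B, B ∈ 𝓑 ∧ V B ⊆ J ∧ Disjoint B J) :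
    #{B ∈ 𝓑 | #(V B) = K} = (d + K - 1).choose (d - 1) := by
  obtain ⟨D, rfl⟩ : ∃ D, d = D + 1 := ⟨d - 1, by omega⟩
  set n := #S with hn
  -- a basis avoiding a `K`-set forces `d + K ≤ n`, so the natural subtractions do not truncate
  have hdK : D + 1 + K ≤ n := by
    obtain ⟨J, hJS, hJ⟩ := exists_subset_card_eq hS
    obtain ⟨B, ⟨hB', -, hBJ⟩, -⟩ := huniq J hJS hJ.le
    rw [← hJ, ← (hB B hB').2, ← card_union_of_disjoint hBJ]
    exact card_le_card (union_subset (hB B hB').1 hJS)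
  have key : ∀ j ≤ K, n.choose j = ∑ i ∈ range (j + 1),
      #{B ∈ 𝓑 | #(V B) = i} * (n - (D + 1) - i).choose (j - i) := by
    intro j hj
    -- the sets `J` assigned to `B` are those between `V B` and `S \ B`
    have hfib : ∀ B ∈ 𝓑, #(V B) ≤ j → #{J ∈ S.powersetCard j | V B ⊆ J ∧ Disjoint B J} =
        (n - (D + 1) - #(V B)).choose (j - #(V B)) := by
      intro B hB' hle
      have := card_filter_powersetCard_superset (hV B hB') hle
      rw [card_sdiff_of_subset (hB B hB').1, (hB B hB').2] at this
      rw [← this]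
      congr 1
      ext J
      simp only [mem_filter, mem_powersetCard, subset_sdiff, disjoint_comm (a := B)]
      tauto
    have hfib0 : ∀ B ∈ 𝓑, ¬ #(V B) ≤ j →
        #{J ∈ S.powersetCard j | V B ⊆ J ∧ Disjoint B J} = 0 := by
      intro B _ hle
      rw [card_eq_zero, filter_eq_empty_iff]
      rintro J hJ ⟨h1, -⟩
      exact hle ((card_le_card h1).trans (mem_powersetCard.1 hJ).2.le)
    calc n.choose j = ∑ J ∈ S.powersetCard j, 1 := by simp [hn]
      _ = ∑ J ∈ S.powersetCard j, #{B ∈ 𝓑 | V B ⊆ J ∧ Disjoint B J} := by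
          refine sum_congr rfl fun J hJ => ?_
          obtain ⟨h1, h2⟩ := mem_powersetCard.1 hJ
          obtain ⟨B, hB1, hB2⟩ := huniq J h1 (h2.le.trans hj)
          refine (card_eq_one.2 ⟨B, ?_⟩).symm
          ext B'
          simp only [mem_filter, mem_singleton]
          exact ⟨fun h => hB2 B' h, fun h => h ▸ hB1⟩
      _ = ∑ B ∈ 𝓑, #{J ∈ S.powersetCard j | V B ⊆ J ∧ Disjoint B J} :=
          sum_card_bipartiteAbove_eq_sum_card_bipartiteBelow _
      _ = ∑ B ∈ 𝓑 with #(V B) ≤ j, #{J ∈ S.powersetCard j | V B ⊆ J ∧ Disjoint B J} := by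
          rw [sum_filter]
          refine sum_congr rfl fun B hB' => ?_
          split_ifs with h
          · rfl
          · exact hfib0 B hB' h
      _ = ∑ i ∈ range (j + 1), ∑ B ∈ {B ∈ 𝓑 | #(V B) ≤ j} with #(V B) = i,
            #{J ∈ S.powersetCard j | V B ⊆ J ∧ Disjoint B J} := by
          refine (sum_fiberwise_of_maps_to (fun B hB' => ?_) _).symm
          have := (mem_filter.1 hB').2
          simp only [mem_range]; omega
      _ = _ := by
          refine sum_congr rfl fun i hi => ?_
          have hi' : i ≤ j := by simp only [mem_range] at hi; omega
          rw [← smul_eq_mul, ← sum_const, filter_filter]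
          have : {B ∈ 𝓑 | #(V B) ≤ j ∧ #(V B) = i} = {B ∈ 𝓑 | #(V B) = i} := by
            ext B; simp only [mem_filter]
            exact ⟨fun h => ⟨h.1, h.2.2⟩, fun h => ⟨h.1, h.2.le.trans hi', h.2⟩⟩
          rw [this]
          refine sum_congr rfl fun B hB' => ?_
          obtain ⟨h1, h2⟩ := mem_filter.1 hB'
          rw [hfib B h1 (h2.le.trans hi'), h2]
  have main : ∀ j ≤ K, #{B ∈ 𝓑 | #(V B) = j} = (D + j).choose D := by
    intro j
    induction j using Nat.strong_induction_on with
    | _ j ih =>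
      intro hj
      have h1 := key j hj
      obtain ⟨q, hq⟩ : ∃ q, n = D + 1 + j + q := ⟨n - (D + 1 + j), by omega⟩
      have h2 := Nat.sum_add_choose_mul_add_choose D q j
      have h3 : n.choose j = (D + q + 1 + j).choose (D + q + 1) := by
        rw [hq, show D + 1 + j + q = D + q + 1 + j by ring]
        exact (Nat.choose_symm_add).symm
      rw [h3, ← h2, sum_range_succ, sum_range_succ] at h1
      have h4 : ∀ i ∈ range j, #{B ∈ 𝓑 | #(V B) = i} * (n - (D + 1) - i).choose (j - i) =
          (D + i).choose D * (q + (j - i)).choose q := by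
        intro i hi
        have hi' := mem_range.1 hi
        rw [ih i hi' (by omega), show n - (D + 1) - i = q + (j - i) by omega]
        congr 1
        exact (Nat.choose_symm_add).symm
      rw [sum_congr rfl h4] at h1
      simpa using h1.symm
  rw [main K le_rfl]
  congr 1; omega

/-! ### Optimal bases of a generic linear program -/

section LinearProgram

variable {E ι : Type*} [NormedAddCommGroup E] [InnerProductSpace ℝ E]

/-- A vector outside a subspace is separated from it by a vector orthogonal to the subspace. -/
theorem Submodule.exists_mem_orthogonal_inner_pos [FiniteDimensional ℝ E]
    {V : Submodule ℝ E} {v : E} (hv : v ∉ V) :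
    ∃ u : E, (∀ x ∈ V, inner ℝ x u = 0) ∧ 0 < inner ℝ v u := by
  refine ⟨v - V.starProjection v, fun x hx => ?_, ?_⟩
  · exact V.inner_right_of_mem_orthogonal hx (V.sub_starProjection_mem_orthogonal v)
  · have h0 : v - V.starProjection v ≠ 0 := by
      intro h
      rw [sub_eq_zero] at h
      exact hv (h ▸ V.starProjection_apply_mem v)
    have h1 : inner ℝ (V.starProjection v) (v - V.starProjection v) = 0 :=
      V.inner_right_of_mem_orthogonal (V.starProjection_apply_mem v)
        (V.sub_starProjection_mem_orthogonal v)
    have h2 : inner ℝ v (v - V.starProjection v) =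
        inner ℝ (v - V.starProjection v) (v - V.starProjection v) := by
      rw [inner_sub_left, h1, sub_zero]
    rw [h2]
    exact real_inner_self_pos.2 h0

/-- First-order optimality: at a maximum `w` of `⟪v, ·⟫` on the polyhedron given by the
constraints in `C`, no direction that respects the tight constraints increases the objective. -/
theorem inner_nonpos_of_isMaxOn {C : Finset ι} {p : ι → E} {h : ι → ℝ} {v w : E}
    (hw : ∀ i ∈ C, inner ℝ (p i) w ≤ h i)
    (hmax : ∀ w', (∀ i ∈ C, inner ℝ (p i) w' ≤ h i) → inner ℝ v w' ≤ inner ℝ v w)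
    {u : E} (hu : ∀ i ∈ C, inner ℝ (p i) w = h i → inner ℝ (p i) u ≤ 0) :
    inner ℝ v u ≤ 0 := by
  have hev : ∀ᶠ t : ℝ in nhdsWithin 0 (Set.Ioi 0), ∀ i ∈ C, inner ℝ (p i) (w + t • u) ≤ h i := by
    rw [Filter.eventually_all_finset]
    intro i hi
    rcases (hw i hi).eq_or_lt with he | hl
    · filter_upwards [self_mem_nhdsWithin] with t ht
      rw [inner_add_right, inner_smul_right, he]
      nlinarith [hu i hi he, Set.mem_Ioi.1 ht]
    · have hc : Continuous fun t : ℝ => inner ℝ (p i) (w + t • u) := by fun_prop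
      have := (hc.tendsto 0).eventually_lt_const (u := h i) (by simpa using hl)
      filter_upwards [nhdsWithin_le_nhds this] with t ht using ht.le
  obtain ⟨t, ht, ht0⟩ := (hev.and self_mem_nhdsWithin).exists
  have h1 := hmax _ ht
  rw [inner_add_right, inner_smul_right] at h1
  have ht0 : 0 < t := ht0
  by_contra hpos
  nlinarith

/-- Linear programming duality at a vertex with linearly independent tight constraints: the
objective `v` of an optimum lies in the cone of the tight constraint normals. Independence
replaces the Farkas lemma, since each coefficient can be tested with a dual direction. -/
theorem exists_nonneg_combination_of_isMaxOn [FiniteDimensional ℝ E] {C : Finset ι} {p : ι → E}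
    {h : ι → ℝ} {v w : E} (hw : ∀ i ∈ C, inner ℝ (p i) w ≤ h i)
    (hmax : ∀ w', (∀ i ∈ C, inner ℝ (p i) w' ≤ h i) → inner ℝ v w' ≤ inner ℝ v w)
    (hli : LinearIndepOn ℝ p ({i ∈ C | inner ℝ (p i) w = h i} : Finset ι)) :
    ∃ c : ι → ℝ, (∀ i ∈ ({i ∈ C | inner ℝ (p i) w = h i} : Finset ι), 0 ≤ c i) ∧
      ∑ i ∈ C with inner ℝ (p i) w = h i, c i • p i = v := by
  classical
  set T : Finset ι := {i ∈ C | inner ℝ (p i) w = h i} with hT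
  have hspan : v ∈ Submodule.span ℝ (p '' T) := by
    by_contra hv
    obtain ⟨u, hu, hpos⟩ := Submodule.exists_mem_orthogonal_inner_pos hv
    refine hpos.not_ge (inner_nonpos_of_isMaxOn hw hmax fun i hi he => (hu _ ?_).le)
    exact Submodule.subset_span ⟨i, by simp [hT, hi, he], rfl⟩
  obtain ⟨c, hc⟩ := (Submodule.mem_span_image_finset_iff_exists_fun ℝ).1 hspan
  set c' : ι → ℝ := fun i => if hi : i ∈ T then c ⟨i, hi⟩ else 0 with hc'
  have hsum : ∑ i ∈ T, c' i • p i = v := by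
    rw [← hc, ← Finset.sum_coe_sort]
    exact Finset.sum_congr rfl fun i _ => by simp [hc']
  refine ⟨c', fun i hi => ?_, hsum⟩
  have hnot : p i ∉ Submodule.span ℝ (p '' (T.erase i : Finset ι)) := by
    refine LinearIndepOn.notMem_span_of_insert ?_ (by simp)
    rwa [← Finset.coe_insert, Finset.insert_erase hi]
  obtain ⟨u, hu, hpos⟩ := Submodule.exists_mem_orthogonal_inner_pos hnot
  have hz : ∀ j ∈ T, j ≠ i → inner ℝ (p j) u = 0 := fun j hj hne =>
    hu _ (Submodule.subset_span ⟨j, by simp [hj, hne], rfl⟩)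
  have h1 : inner ℝ v (-u) ≤ 0 := by
    refine inner_nonpos_of_isMaxOn hw hmax fun j hj he => ?_
    rw [inner_neg_right]
    by_cases hji : j = i
    · subst hji; linarith
    · rw [hz j (by simp [hT, hj, he]) hji, neg_zero]
  have h2 : inner ℝ v u = c' i * inner ℝ (p i) u := by
    rw [← hsum, sum_inner, Finset.sum_eq_single i]
    · rw [real_inner_smul_left]
    · intro j hj hne
      rw [real_inner_smul_left, hz j hj hne, mul_zero]
    · exact fun h => absurd hi h
  rw [inner_neg_right, h2] at h1
  by_contra hneg
  nlinarith

/-- Complementary slackness: if `v` is a positive combination of the normals in `B`, a feasible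
point reaching the dual value is tight on all of `B`. -/
theorem inner_eq_of_le_of_pos_combination {B : Finset ι} {p : ι → E} {h : ι → ℝ} {c : ι → ℝ}
    (hc : ∀ i ∈ B, 0 < c i) {v w : E} (hv : ∑ i ∈ B, c i • p i = v)
    (hw : ∀ i ∈ B, inner ℝ (p i) w ≤ h i) (hle : ∑ i ∈ B, c i * h i ≤ inner ℝ v w) :
    ∀ i ∈ B, inner ℝ (p i) w = h i := by
  rw [← hv, sum_inner] at hle
  simp only [real_inner_smul_left] at hle
  have hterm : ∀ i ∈ B, c i * inner ℝ (p i) w ≤ c i * h i := fun i hi =>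
    mul_le_mul_of_nonneg_left (hw i hi) (hc i hi).le
  intro i hi
  exact mul_left_cancel₀ (hc i hi).ne'
    ((Finset.sum_eq_sum_iff_of_le hterm).1 ((Finset.sum_le_sum hterm).antisymm hle) i hi)

theorem pos_of_nonneg_combination {B : Finset ι} {p : ι → E} {c : ι → ℝ} {v : E}
    (hc : ∀ i ∈ B, 0 ≤ c i) (hv : ∑ i ∈ B, c i • p i = v)
    (hgen : ∀ T ⊂ B, v ∉ Submodule.span ℝ (p '' T)) : ∀ i ∈ B, 0 < c i := by
  classical
  intro i hi
  refine (hc i hi).lt_of_ne fun h0 => hgen (B.erase i) (Finset.erase_ssubset hi) ?_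
  rw [← hv, ← Finset.sum_erase _ (a := i) (by simp [← h0])]
  exact Submodule.sum_mem _ fun j hj => Submodule.smul_mem _ _
    (Submodule.subset_span ⟨j, Finset.mem_coe.2 hj, rfl⟩)

open Finset in
/-- Consider the linear program of maximizing `⟪v, w⟫` subject to `⟪p i, w⟫ ≤ h i` for `i ∈ S`. It
is feasible at `w = 0`, nondegenerate (`hli`, `htight`), has a generic objective (`hv`), and stays
bounded after deleting any `K` constraints (`hM`). The bases counted are the `d`-sets of
constraints which, taken alone, have their optimum at their common vertex, and whose vertex
violates exactly `K` constraints of `S`. -/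
theorem card_optimalBases_with_violations [FiniteDimensional ℝ E] {d K : ℕ} (hd : 1 ≤ d)
    (hE : Module.finrank ℝ E = d)
    {S : Finset ι} {p : ι → E} {h : ι → ℝ} (hpos : ∀ i ∈ S, 0 < h i)
    (hli : ∀ T ⊆ S, #T ≤ d → LinearIndepOn ℝ p T)
    (htight : ∀ w, #{i ∈ S | inner ℝ (p i) w = h i} ≤ d)
    {M : ℝ} (hM : ∀ w, M < ‖w‖ → K < #{i ∈ S | h i < inner ℝ (p i) w})
    {v : E} (hv : ∀ T ⊆ S, #T < d → v ∉ Submodule.span ℝ (p '' T)) :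
    {B : Finset ι | (B ⊆ S ∧ #B = d) ∧ (∃ c : ι → ℝ, (∀ i ∈ B, 0 ≤ c i) ∧ ∑ i ∈ B, c i • p i = v) ∧
      ∃ w, (∀ i ∈ B, inner ℝ (p i) w = h i) ∧ #{i ∈ S | h i < inner ℝ (p i) w} = K}.encard =
    ((d + K - 1).choose (d - 1) : ℕ) := by
  classical
  -- the vertex where the constraints of a basis are tight is unique
  have hw_unique : ∀ B ⊆ S, #B = d → ∀ w w', (∀ i ∈ B, inner ℝ (p i) w = h i) →
      (∀ i ∈ B, inner ℝ (p i) w' = h i) → w = w' := by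
    intro B hBS hBd w w' hw hw'
    by_contra hne
    have htop : Submodule.span ℝ (Set.range fun i : (B : Set ι) => p i) = ⊤ :=
      LinearIndependent.span_eq_top_of_card_eq_finrank' (hli B hBS hBd.le)
        (by simp [hE, hBd])
    have hmem : w - w' ∈ Submodule.span ℝ (Set.range fun i : (B : Set ι) => p i) := by
      rw [htop]; trivial
    have hker : Submodule.span ℝ (Set.range fun i : (B : Set ι) => p i) ≤
        (ℝ ∙ (w - w'))ᗮ := by
      rw [Submodule.span_le]
      rintro _ ⟨⟨i, hi⟩, rfl⟩
      rw [SetLike.mem_coe, Submodule.mem_orthogonal_singleton_iff_inner_left, inner_sub_right,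
        hw i hi, hw' i hi, sub_self]
    have := (Submodule.mem_orthogonal_singleton_iff_inner_left).1 (hker hmem)
    exact hne (sub_eq_zero.1 (inner_self_eq_zero.1 this))
  let P : Finset ι → E → Prop := fun B w => ∀ i ∈ B, inner ℝ (p i) w = h i
  let W : Finset ι → E := fun B => if hB : ∃ w, P B w then hB.choose else 0
  have hW : ∀ B, (∃ w, P B w) → P B (W B) := by
    intro B hB
    simp only [W, hB, dif_pos]
    exact hB.choose_spec
  let viol : E → Finset ι := fun w => {i ∈ S | h i < inner ℝ (p i) w}
  let 𝓑 : Finset (Finset ι) := {B ∈ S.powersetCard d |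
    (∃ c : ι → ℝ, (∀ i ∈ B, 0 ≤ c i) ∧ ∑ i ∈ B, c i • p i = v) ∧ ∃ w, P B w}
  have h𝓑 : ∀ B, B ∈ 𝓑 ↔ (B ⊆ S ∧ #B = d) ∧
      (∃ c : ι → ℝ, (∀ i ∈ B, 0 ≤ c i) ∧ ∑ i ∈ B, c i • p i = v) ∧ ∃ w, P B w := by
    intro B; simp only [𝓑, mem_filter, mem_powersetCard]
  have hset : {B : Finset ι | (B ⊆ S ∧ #B = d) ∧
      (∃ c : ι → ℝ, (∀ i ∈ B, 0 ≤ c i) ∧ ∑ i ∈ B, c i • p i = v) ∧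
      ∃ w, (∀ i ∈ B, inner ℝ (p i) w = h i) ∧ #{i ∈ S | h i < inner ℝ (p i) w} = K} =
      ({B ∈ 𝓑 | #(viol (W B)) = K} : Finset (Finset ι)) := by
    ext B
    simp only [Set.mem_ofPred_eq, mem_coe, mem_filter, h𝓑]
    constructor
    · rintro ⟨h1, h2, w, hw, hcard⟩
      refine ⟨⟨h1, h2, w, hw⟩, ?_⟩
      rw [hw_unique B h1.1 h1.2 (W B) w (hW B ⟨w, hw⟩) hw]
      exact hcard
    · rintro ⟨⟨h1, h2, hw⟩, hcard⟩
      exact ⟨h1, h2, W B, hW B hw, hcard⟩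
  rw [hset, Set.encard_coe_eq_coe_finsetCard]
  congr 1
  have : Nontrivial E := Module.nontrivial_of_finrank_pos (R := ℝ) (by omega)
  have hcardS : K ≤ #S := by
    obtain ⟨w, hw⟩ := NormedSpace.exists_lt_norm ℝ E M
    exact (hM w hw).le.trans (card_filter_le _ _)
  refine card_bases_of_existsUnique hd hcardS 𝓑 (fun B => viol (W B))
    (fun B hB => ((h𝓑 B).1 hB).1) ?_ ?_
  · intro B hB i hi
    obtain ⟨hiS, hlt⟩ := mem_filter.1 hi
    refine mem_sdiff.2 ⟨hiS, fun hiB => ?_⟩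
    exact hlt.ne' (hW B ((h𝓑 B).1 hB).2.2 i hiB)
  intro J hJS hJ
  have hpos_c : ∀ B ∈ 𝓑, ∃ c : ι → ℝ, (∀ i ∈ B, 0 < c i) ∧ ∑ i ∈ B, c i • p i = v := by
    intro B hB
    obtain ⟨⟨hBS, hBd⟩, ⟨c, hc, hcv⟩, -⟩ := (h𝓑 B).1 hB
    exact ⟨c, pos_of_nonneg_combination hc hcv fun T hT =>
      hv T (hT.subset.trans hBS) (hBd ▸ card_lt_card hT), hcv⟩
  -- feasibility for the constraints outside `J`
  have hfeas : ∀ B, viol (W B) ⊆ J → ∀ i ∈ S \ J, inner ℝ (p i) (W B) ≤ h i := by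
    intro B hVJ i hi
    by_contra hlt
    exact (mem_sdiff.1 hi).2 (hVJ (mem_filter.2 ⟨(mem_sdiff.1 hi).1, not_le.1 hlt⟩))
  -- weak duality compares the optimal values at two bases
  have hval : ∀ B ∈ 𝓑, Disjoint B J → ∀ w, (∀ i ∈ S \ J, inner ℝ (p i) w ≤ h i) →
      inner ℝ v (W B) ≤ inner ℝ v w → ∀ i ∈ B, inner ℝ (p i) w = h i := by
    intro B hB hBJ w hw hle
    obtain ⟨c, hc, hcv⟩ := hpos_c B hB
    obtain ⟨⟨hBS, -⟩, -, hex⟩ := (h𝓑 B).1 hB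
    refine inner_eq_of_le_of_pos_combination hc hcv
      (fun i hi => hw i (mem_sdiff.2 ⟨hBS hi, disjoint_left.1 hBJ hi⟩)) ?_
    refine le_trans (le_of_eq ?_) hle
    rw [← hcv, sum_inner]
    exact sum_congr rfl fun i hi => by rw [real_inner_smul_left, hW B hex i hi]
  have htight_eq : ∀ B ⊆ S, #B = d → ∀ w, P B w → B = {i ∈ S | inner ℝ (p i) w = h i} := by
    intro B hBS hBd w hw
    exact eq_of_subset_of_card_le (fun i hi => mem_filter.2 ⟨hBS hi, hw i hi⟩)
      (hBd ▸ htight w)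
  refine existsUnique_of_exists_of_unique ?_ ?_
  · -- existence: an optimal vertex of the linear program without the constraints in `J`
    set Q : Set E := {w | ∀ i ∈ S \ J, inner ℝ (p i) w ≤ h i} with hQ
    have hviolQ : ∀ w ∈ Q, viol w ⊆ J := by
      intro w hw i hi
      by_contra hiJ
      obtain ⟨hiS, hlt⟩ := mem_filter.1 hi
      exact hlt.not_ge (hw i (mem_sdiff.2 ⟨hiS, hiJ⟩))
    have hQc : IsCompact Q := by
      refine Metric.isCompact_of_isClosed_isBounded ?_ ?_
      · simp only [hQ, Set.ofPred_forall]
        exact isClosed_biInter fun i _ => isClosed_le (by fun_prop) continuous_const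
      · refine (isBounded_iff_forall_norm_le).2 ⟨M, fun w hw => ?_⟩
        by_contra hlt
        have h1 := hM w (not_le.1 hlt)
        have h2 := card_le_card (hviolQ w hw)
        have h3 : K < #(viol w) := h1
        omega
    have hQ0 : Q.Nonempty := ⟨0, fun i hi => by
      rw [inner_zero_right]; exact (hpos i (mem_sdiff.1 hi).1).le⟩
    obtain ⟨w, hwQ, hmax⟩ := hQc.exists_isMaxOn hQ0
      (f := fun w => (inner ℝ v w : ℝ)) (by fun_prop)
    set T : Finset ι := {i ∈ S \ J | inner ℝ (p i) w = h i} with hT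
    have hTS : T ⊆ S := (filter_subset _ _).trans sdiff_subset
    have hTd : #T ≤ d :=
      (card_le_card (filter_subset_filter _ sdiff_subset)).trans (htight w)
    obtain ⟨c, hc, hcv⟩ := exists_nonneg_combination_of_isMaxOn hwQ
      (fun w' hw' => hmax hw') (hli T hTS hTd)
    have hTd' : #T = d := by
      refine hTd.antisymm (not_lt.1 fun hlt => hv T hTS hlt ?_)
      rw [← hcv]
      exact Submodule.sum_mem _ fun j hj => Submodule.smul_mem _ _
        (Submodule.subset_span ⟨j, hj, rfl⟩)
    have hPT : P T w := fun i hi => (mem_filter.1 hi).2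
    refine ⟨T, (h𝓑 T).2 ⟨⟨hTS, hTd'⟩, ⟨c, hc, hcv⟩, w, hPT⟩, ?_, ?_⟩
    · rw [hw_unique T hTS hTd' (W T) w (hW T ⟨w, hPT⟩) hPT]
      exact hviolQ w hwQ
    · exact disjoint_left.2 fun i hi => (mem_sdiff.1 (mem_filter.1 hi).1).2
  · rintro B₁ B₂ ⟨h1, hV1, hD1⟩ ⟨h2, hV2, hD2⟩
    wlog hle : inner ℝ v (W B₁) ≤ inner ℝ v (W B₂) generalizing B₁ B₂
    · exact (this B₂ B₁ h2 hV2 hD2 h1 hV1 hD1 (not_le.1 hle).le).symm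
    have h3 := hval B₁ h1 hD1 (W B₂) (hfeas B₂ hV2) hle
    obtain ⟨⟨hS1, hc1⟩, -, -⟩ := (h𝓑 B₁).1 h1
    obtain ⟨⟨hS2, hc2⟩, -, hex⟩ := (h𝓑 B₂).1 h2
    exact (htight_eq B₁ hS1 hc1 _ h3).trans (htight_eq B₂ hS2 hc2 _ (hW B₂ hex)).symm

end LinearProgram

/-! ### Thin Delone sets and bounded depth -/

section HalfSpaces

variable {d : ℕ} {A : Set (EuclideanSpace ℝ (Fin d))}

/-- Each open half-space with `a` on its boundary contains infinitely many points of `A`, because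
closed half-spaces arbitrarily far out in the same direction are all met. -/
theorem CoarselyDense.infinite_inner_pos (hA : CoarselyDense A) (a : EuclideanSpace ℝ (Fin d))
    {u : EuclideanSpace ℝ (Fin d)} (hu : u ≠ 0) : {b ∈ A | 0 < inner ℝ (b - a) u}.Infinite := by
  intro hfin
  obtain ⟨C, hC⟩ := (hfin.image fun b => inner ℝ u b).bddAbove
  obtain ⟨x, hxA, hx⟩ := hA u (max C (inner ℝ u a) + 1) hu
  have h1 := le_max_left C (inner ℝ u a)
  have h2 := le_max_right C (inner ℝ u a)
  have h3 : inner ℝ u x ≤ C := hC ⟨x, ⟨hxA, by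
    rw [real_inner_comm, inner_sub_right]; linarith⟩, rfl⟩
  linarith

theorem CoarselyDense.infinite (hA : CoarselyDense A) (hd : 1 ≤ d) : A.Infinite := by
  have : Nontrivial (EuclideanSpace ℝ (Fin d)) :=
    Module.nontrivial_of_finrank_pos (R := ℝ) (by rw [finrank_euclideanSpace_fin]; omega)
  obtain ⟨u, hu⟩ := exists_ne (0 : EuclideanSpace ℝ (Fin d))
  exact (hA.infinite_inner_pos 0 hu).mono fun b hb => hb.1

/-- A large ball with `a` on its boundary contains many points of `A` near `a`: the condition
`‖b - a‖ ^ 2 < ⟪b - a, w⟫` says that `b` is in the open ball with center `a + w / 2` and radius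
`‖w‖ / 2`. The radius `M` that works for all directions of `w` comes from compactness of the
unit sphere. -/
theorem CoarselyDense.exists_forall_le_encard (hA : CoarselyDense A)
    (a : EuclideanSpace ℝ (Fin d)) (K : ℕ) :
    ∃ M : ℝ, ∀ w, M < ‖w‖ →
      (K : ℕ∞) ≤ {b ∈ A | ‖b - a‖ ≤ M ∧ ‖b - a‖ ^ 2 < inner ℝ (b - a) w}.encard := by
  have key : ∃ M : ℝ, ∀ u ∈ Metric.sphere (0 : EuclideanSpace ℝ (Fin d)) 1, ∀ t, M < t →
      (K : ℕ∞) ≤ {b ∈ A | ‖b - a‖ ≤ M ∧ ‖b - a‖ ^ 2 < t * inner ℝ (b - a) u}.encard := by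
    refine (isCompact_sphere (0 : EuclideanSpace ℝ (Fin d)) 1).induction_on
      (p := fun U => ∃ M : ℝ, ∀ u ∈ U, ∀ t, M < t →
        (K : ℕ∞) ≤ {b ∈ A | ‖b - a‖ ≤ M ∧ ‖b - a‖ ^ 2 < t * inner ℝ (b - a) u}.encard)
      ⟨0, by simp⟩ ?_ ?_ ?_
    · rintro U U' hUU' ⟨M, hM⟩
      exact ⟨M, fun u hu => hM u (hUU' hu)⟩
    · rintro U U' ⟨M, hM⟩ ⟨M', hM'⟩
      refine ⟨max M M', fun u hu t ht => ?_⟩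
      rcases hu with hu | hu
      · exact (hM u hu t ((le_max_left _ _).trans_lt ht)).trans (Set.encard_le_encard
          fun b hb => ⟨hb.1, hb.2.1.trans (le_max_left _ _), hb.2.2⟩)
      · exact (hM' u hu t ((le_max_right _ _).trans_lt ht)).trans (Set.encard_le_encard
          fun b hb => ⟨hb.1, hb.2.1.trans (le_max_right _ _), hb.2.2⟩)
    · intro u hu
      have hu0 : u ≠ 0 := by
        rintro rfl; simp at hu
      obtain ⟨F, hF, hFK⟩ := (hA.infinite_inner_pos a hu0).exists_subset_card_eq K
      -- `m b` bounds both `‖b - a‖` and the length beyond which the ball in a direction near `u`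
      -- contains `b`
      let m : EuclideanSpace ℝ (Fin d) → ℝ := fun b =>
        ‖b - a‖ + ‖b - a‖ ^ 2 / (inner ℝ (b - a) u / 2)
      have hm2 : ∀ b ∈ F, 0 ≤ ‖b - a‖ ^ 2 / (inner ℝ (b - a) u / 2) := fun b hb => by
        have := (hF hb).2
        positivity
      have hm : ∀ b ∈ F, m b ≤ ∑ b ∈ F, m b := fun b hb =>
        Finset.single_le_sum (f := m)
          (fun i hi => add_nonneg (norm_nonneg _) (hm2 i hi)) hb
      refine ⟨{u' | ∀ b ∈ F, inner ℝ (b - a) u / 2 < inner ℝ (b - a) u'},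
        mem_nhdsWithin_of_mem_nhds ?_, ∑ b ∈ F, m b, ?_⟩
      · refine (Filter.eventually_all_finset F).2 fun b hb => ?_
        have hc : Continuous fun u' : EuclideanSpace ℝ (Fin d) => inner ℝ (b - a) u' := by
          fun_prop
        have hpos := (hF hb).2
        exact (hc.tendsto u).eventually_const_lt (by linarith)
      · intro u' hu' t ht
        rw [← hFK, ← Set.encard_coe_eq_coe_finsetCard]
        refine Set.encard_le_encard fun b hb => ⟨(hF hb).1, ?_, ?_⟩
        · exact (le_add_of_nonneg_right (hm2 b hb)).trans (hm b hb)
        · have hpos := (hF hb).2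
          have h1 : ‖b - a‖ ^ 2 / (inner ℝ (b - a) u / 2) < t :=
            ((le_add_of_nonneg_left (norm_nonneg _)).trans (hm b hb)).trans_lt ht
          have h2 := hu' b hb
          have h3 : 0 < t := (hm2 b hb).trans_lt h1
          rw [div_lt_iff₀ (by linarith)] at h1
          exact h1.trans (mul_lt_mul_of_pos_left h2 h3)
  obtain ⟨M, hM⟩ := key
  refine ⟨max M 0, fun w hw => ?_⟩
  have hw0 : 0 < ‖w‖ := (le_max_right _ _).trans_lt hw
  have h1 := hM (‖w‖⁻¹ • w) (by simp [norm_smul, hw0.ne']) ‖w‖ ((le_max_left _ _).trans_lt hw)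
  refine h1.trans (Set.encard_le_encard fun b hb => ⟨hb.1, hb.2.1.trans (le_max_left _ _), ?_⟩)
  have h2 := hb.2.2
  rwa [inner_smul_right, mul_inv_cancel_left₀ hw0.ne'] at h2

end HalfSpaces

/-! ### Generic point sets -/

section Genericity

variable {d : ℕ} {A : Set (EuclideanSpace ℝ (Fin d))}

theorem Set.Infinite.exists_finset_superset_card_eq {α : Type*} {s : Set α} (hs : s.Infinite)
    {T : Finset α} (hT : (T : Set α) ⊆ s) {m : ℕ} (hm : T.card ≤ m) :
    ∃ T' : Finset α, T ⊆ T' ∧ (T' : Set α) ⊆ s ∧ T'.card = m := by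
  classical
  obtain ⟨t, ht, htm⟩ := (hs.sdiff T.finite_toSet).exists_subset_card_eq (m - T.card)
  refine ⟨T ∪ t, Finset.subset_union_left, ?_, ?_⟩
  · rw [Finset.coe_union]
    exact Set.union_subset hT fun x hx => (ht hx).1
  · rw [Finset.card_union_of_disjoint, htm]
    · omega
    · exact Finset.disjoint_left.2 fun x hx hx' => (ht hx').2 hx

/-- The differences of `d + 1` points of a generic set to any point `a` span the whole space;
otherwise a vector orthogonal to them would define a hyperplane through all the points. -/
theorem IsGenericSet.span_eq_top (hA : IsGenericSet A) {a : EuclideanSpace ℝ (Fin d)}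
    {s : Finset (EuclideanSpace ℝ (Fin d))} (hs : (s : Set (EuclideanSpace ℝ (Fin d))) ⊆ A)
    (hcard : s.card = d + 1) {V : Submodule ℝ (EuclideanSpace ℝ (Fin d))}
    (hV : ∀ x ∈ s, x - a ∈ V) : V = ⊤ := by
  by_contra hne
  obtain ⟨v, hv⟩ := SetLike.exists_not_mem_of_ne_top V hne
  obtain ⟨u, hu, hpos⟩ := Submodule.exists_mem_orthogonal_inner_pos hv
  refine hA.1 s hs hcard ⟨u, inner ℝ u a, ?_, fun x hx => ?_⟩
  · rintro rfl; simp at hpos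
  · have := hu _ (hV x hx)
    rw [real_inner_comm, inner_sub_right, sub_eq_zero] at this
    exact this

theorem IsGenericSet.linearIndepOn_sub (hA : IsGenericSet A) (hinf : A.Infinite)
    {a : EuclideanSpace ℝ (Fin d)} (ha : a ∈ A) {T : Finset (EuclideanSpace ℝ (Fin d))}
    (hT : (T : Set (EuclideanSpace ℝ (Fin d))) ⊆ A \ {a}) (hcard : T.card ≤ d) :
    LinearIndepOn ℝ (fun b => b - a) (T : Set (EuclideanSpace ℝ (Fin d))) := by
  classical
  obtain ⟨T', hTT', hT', hcard'⟩ :=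
    (hinf.sdiff (Set.finite_singleton a)).exists_finset_superset_card_eq hT hcard
  refine LinearIndepOn.mono ?_ (Finset.coe_subset.2 hTT')
  have haT' : a ∉ T' := fun h => (hT' h).2 rfl
  have htop : Submodule.span ℝ (Set.range fun i : (T' : Set (EuclideanSpace ℝ (Fin d))) =>
      (i : EuclideanSpace ℝ (Fin d)) - a) = ⊤ := by
    refine hA.span_eq_top (s := insert a T') (a := a) ?_ ?_ ?_
    · rw [Finset.coe_insert]
      exact Set.insert_subset ha fun x hx => (hT' hx).1
    · rw [Finset.card_insert_of_notMem haT', hcard']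
    · intro x hx
      rcases Finset.mem_insert.1 hx with rfl | hx
      · simp
      · exact Submodule.subset_span ⟨⟨x, hx⟩, rfl⟩
  exact linearIndependent_of_top_le_span_of_card_eq_finrank htop.ge (by simp [hcard'])

theorem span_sub_ne_top {a : EuclideanSpace ℝ (Fin d)}
    {T : Finset (EuclideanSpace ℝ (Fin d))} (hT : T.card < d) :
    Submodule.span ℝ ((fun b => b - a) '' (T : Set (EuclideanSpace ℝ (Fin d)))) ≠ ⊤ := by
  classical
  intro htop
  have h1 := finrank_span_finset_le_card (R := ℝ) (T.image fun b => b - a)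
  rw [Finset.coe_image, Set.finrank, htop, finrank_top, finrank_euclideanSpace_fin] at h1
  exact absurd (h1.trans Finset.card_image_le) (not_le.2 hT)

theorem IsGenericWrt.sub_notMem_span (hinf : A.Infinite) {a y : EuclideanSpace ℝ (Fin d)}
    (hy : IsGenericWrt A y) (ha : a ∈ A) {T : Finset (EuclideanSpace ℝ (Fin d))}
    (hT : (T : Set (EuclideanSpace ℝ (Fin d))) ⊆ A \ {a}) (hcard : T.card < d) :
    y - a ∉ Submodule.span ℝ ((fun b => b - a) '' (T : Set (EuclideanSpace ℝ (Fin d)))) := by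
  classical
  intro hmem
  obtain ⟨T', hTT', hT', hcard'⟩ :=
    (hinf.sdiff (Set.finite_singleton a)).exists_finset_superset_card_eq hT
      (Nat.le_sub_one_of_lt hcard)
  refine span_sub_ne_top (T := T') (a := a) (by omega) ?_
  have haT' : a ∉ T' := fun h => (hT' h).2 rfl
  have hyT' : y ∉ insert a T' := fun h => hy.1 (by
    rcases Finset.mem_insert.1 h with rfl | h
    exacts [ha, (hT' h).1])
  refine hy.2.span_eq_top (s := insert y (insert a T')) (a := a) ?_ ?_ ?_
  · rw [Finset.coe_insert, Finset.coe_insert]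
    exact Set.insert_subset (Or.inr rfl)
      (Set.insert_subset (Or.inl ha) fun x hx => Or.inl (hT' hx).1)
  · rw [Finset.card_insert_of_notMem hyT', Finset.card_insert_of_notMem haT', hcard']
    omega
  · intro x hx
    rcases Finset.mem_insert.1 hx with rfl | hx
    · exact Submodule.span_mono (Set.image_mono (Finset.coe_subset.2 hTT')) hmem
    rcases Finset.mem_insert.1 hx with rfl | hx
    · simp
    · exact Submodule.subset_span ⟨x, hx, rfl⟩

theorem norm_sub_midpoint_sq {E : Type*} [NormedAddCommGroup E] [InnerProductSpace ℝ E]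
    (a b w : E) : ‖b - (a + (1 / 2 : ℝ) • w)‖ ^ 2 =
      ‖b - a‖ ^ 2 - inner ℝ (b - a) w + (‖w‖ / 2) ^ 2 := by
  rw [← sub_sub, norm_sub_sq_real, inner_smul_right, norm_smul]
  norm_num
  ring

theorem mem_sphere_iff_inner_eq {E : Type*} [NormedAddCommGroup E] [InnerProductSpace ℝ E]
    {a b w : E} : b ∈ Metric.sphere (a + (1 / 2 : ℝ) • w) (‖w‖ / 2) ↔
      inner ℝ (b - a) w = ‖b - a‖ ^ 2 := by
  rw [mem_sphere_iff_norm, ← sq_eq_sq₀ (norm_nonneg _) (by positivity), norm_sub_midpoint_sq]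
  constructor <;> intro h <;> linarith

theorem mem_ball_iff_lt_inner {E : Type*} [NormedAddCommGroup E] [InnerProductSpace ℝ E]
    {a b w : E} : b ∈ Metric.ball (a + (1 / 2 : ℝ) • w) (‖w‖ / 2) ↔
      ‖b - a‖ ^ 2 < inner ℝ (b - a) w := by
  rw [mem_ball_iff_norm, ← sq_lt_sq₀ (norm_nonneg _) (by positivity), norm_sub_midpoint_sq]
  constructor <;> intro h <;> linarith

/-- The points of `A \ {a}` on the sphere with center `a + w / 2` through `a` number at most `d`.
-/
theorem IsGenericSet.card_tight_le (hA : IsGenericSet A) {a : EuclideanSpace ℝ (Fin d)}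
    (ha : a ∈ A) {T : Finset (EuclideanSpace ℝ (Fin d))}
    (hT : (T : Set (EuclideanSpace ℝ (Fin d))) ⊆ A \ {a}) {w : EuclideanSpace ℝ (Fin d)}
    (hw : ∀ b ∈ T, inner ℝ (b - a) w = ‖b - a‖ ^ 2) : T.card ≤ d := by
  classical
  by_contra hlt
  obtain ⟨T', hT'T, hcard⟩ := Finset.exists_subset_card_eq (n := d + 1) (by omega : d + 1 ≤ T.card)
  have haT' : a ∉ T' := fun h => (hT (hT'T h)).2 rfl
  have hw0 : w ≠ 0 := by
    rintro rfl
    obtain ⟨b, hb⟩ := Finset.card_pos.1 (by omega : 0 < T'.card)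
    have h1 := hw b (hT'T hb)
    rw [inner_zero_right, eq_comm, sq_eq_zero_iff, norm_eq_zero, sub_eq_zero] at h1
    exact haT' (h1 ▸ hb)
  refine hA.2 (insert a T') ?_ (by rw [Finset.card_insert_of_notMem haT', hcard])
    ⟨a + (1 / 2 : ℝ) • w, ‖w‖ / 2, by positivity, ?_⟩
  · rw [Finset.coe_insert]
    exact Set.insert_subset ha fun x hx => (hT (hT'T hx)).1
  · rw [Finset.coe_insert]
    refine Set.insert_subset ?_ fun b hb => ?_
    · rw [mem_sphere_iff_inner_eq]; simp
    · exact mem_sphere_iff_inner_eq.2 (hw b (hT'T hb))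

end Genericity

/-! ### A simplex near one of its vertices -/

section LocalCone

variable {E : Type*} [NormedAddCommGroup E] [NormedSpace ℝ E]

/-- A simplex with vertex `a` is contained in the cone at `a` spanned by its other vertices. -/
theorem exists_nonneg_combination_of_mem_convexHull_insert [DecidableEq E] {a : E} {B : Finset E}
    (haB : a ∉ B) {y : E} (hy : y ∈ convexHull ℝ ((insert a B : Finset E) : Set E)) :
    ∃ c : E → ℝ, (∀ b ∈ B, 0 ≤ c b) ∧ ∑ b ∈ B, c b • (b - a) = y - a := by
  obtain ⟨c, hc, hc1, hcy⟩ := Finset.mem_convexHull'.1 hy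
  refine ⟨c, fun b hb => hc b (Finset.mem_insert_of_mem hb), ?_⟩
  rw [Finset.sum_insert haB] at hc1 hcy
  simp only [smul_sub, Finset.sum_sub_distrib, ← Finset.sum_smul]
  rw [← hcy, show ∑ b ∈ B, c b = 1 - c a by linarith, sub_smul, one_smul]
  abel

/-- Near its vertex `a`, a simplex agrees with the cone at `a` spanned by its other vertices. -/
theorem eventually_mem_convexHull_insert_iff [FiniteDimensional ℝ E] [DecidableEq E] {a : E}
    {B : Finset E} (haB : a ∉ B)
    (hli : LinearIndepOn ℝ (fun b => b - a) (B : Set E)) :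
    ∀ᶠ y in nhds a, (y ∈ convexHull ℝ ((insert a B : Finset E) : Set E) ↔
      ∃ c : E → ℝ, (∀ b ∈ B, 0 ≤ c b) ∧ ∑ b ∈ B, c b • (b - a) = y - a) := by
  -- the coefficients are controlled by `‖y - a‖`, so their sum is at most `1` near `a`
  obtain ⟨C, hC0, hC⟩ := LinearMap.exists_antilipschitzWith
    (Fintype.linearCombination ℝ fun b : (B : Set E) => (b : E) - a)
    (LinearMap.ker_eq_bot.2 (linearIndependent_iff_injective_fintypeLinearCombination.1 hli))
  have hpos : 0 < ((B.card : ℝ) * C + 1)⁻¹ := by positivity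
  filter_upwards [Metric.ball_mem_nhds a hpos] with y hy
  refine ⟨exists_nonneg_combination_of_mem_convexHull_insert haB, ?_⟩
  rintro ⟨c, hc, hcy⟩
  have hle : ∑ b ∈ B, c b ≤ 1 := by
    have h1 : ∀ b ∈ B, c b ≤ C * ‖y - a‖ := by
      intro b hb
      have h2 := hC.le_mul_dist (fun i => c i) 0
      rw [map_zero, dist_zero_right, dist_zero_right, Fintype.linearCombination_apply,
        ← Finset.sum_subtype B (by simp) (fun b => c b • (b - a)), hcy] at h2
      exact ((le_abs_self _).trans
        (norm_le_pi_norm (fun i : (B : Set E) => c i) ⟨b, hb⟩)).trans h2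
    have h3 := Finset.sum_le_card_nsmul B c _ h1
    rw [nsmul_eq_mul] at h3
    refine h3.trans ?_
    have h4 := mem_ball_iff_norm.1 hy
    rw [← one_div, lt_div_iff₀ (by positivity)] at h4
    nlinarith [norm_nonneg (y - a)]
  refine Finset.mem_convexHull'.2 ⟨fun x => if x = a then 1 - ∑ b ∈ B, c b else c x, ?_, ?_, ?_⟩
  · intro x hx'
    rcases Finset.mem_insert.1 hx' with rfl | hx
    · simpa using hle
    · have hxa : x ≠ a := by rintro rfl; exact haB hx
      simpa only [if_neg hxa] using hc x hx
  all_goals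
    have hif : ∀ b ∈ B, (if b = a then 1 - ∑ b ∈ B, c b else c b) = c b := fun b hb =>
      if_neg (by rintro rfl; exact haB hb)
    simp only [Finset.sum_insert haB, if_true]
  · rw [Finset.sum_congr rfl hif]; ring
  · rw [Finset.sum_congr rfl fun b hb => congrArg (· • b) (hif b hb)]
    simp only [smul_sub, Finset.sum_sub_distrib, ← Finset.sum_smul] at hcy
    rw [sub_eq_iff_eq_add.1 hcy, sub_smul, one_smul]
    abel

end LocalCone

/-! ### Hefty simplices at a vertex as bases of a linear program -/

section HeftySimplices

variable {d k : ℕ} {A : Set (EuclideanSpace ℝ (Fin d))} {a : EuclideanSpace ℝ (Fin d)}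

open Finset in
/-- The dictionary between simplices and linear programs. Write the center of a sphere through `a`
as `a + w / 2`. Then `b` lies on the sphere when `⟪b - a, w⟫ = ‖b - a‖ ^ 2` and inside when `‖b -
a‖ ^ 2 < ⟪b - a, w⟫`, so a `k`-hefty simplex at `a` is a `d`-set of constraints whose vertex `w`
violates exactly `k` constraints. By `hM` such a `w` has norm at most `M`, so the points of `A` at
distance at most `M` from `a` suffice. -/
theorem isHeftySimplex_insert_iff [DecidableEq (EuclideanSpace ℝ (Fin d))] (hd : 1 ≤ d)
    (ha : a ∈ A) {M : ℝ} {S : Finset (EuclideanSpace ℝ (Fin d))}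
    (hS : ∀ b, b ∈ S ↔ (b ∈ A ∧ ‖b - a‖ ≤ M) ∧ b ≠ a)
    (hM : ∀ w, M < ‖w‖ → k < #{b ∈ S | ‖b - a‖ ^ 2 < inner ℝ (b - a) w})
    (hli : ∀ T ⊆ S, #T ≤ d →
      LinearIndepOn ℝ (fun b => b - a) (T : Set (EuclideanSpace ℝ (Fin d))))
    {B : Finset (EuclideanSpace ℝ (Fin d))} (haB : a ∉ B) :
    IsHeftySimplex k A (insert a B) ↔ (B ⊆ S ∧ #B = d) ∧
      ∃ w, (∀ b ∈ B, inner ℝ (b - a) w = ‖b - a‖ ^ 2) ∧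
        #{b ∈ S | ‖b - a‖ ^ 2 < inner ℝ (b - a) w} = k := by
  have hle_of : ∀ w b, ‖b - a‖ ^ 2 ≤ inner ℝ (b - a) w → ‖b - a‖ ≤ ‖w‖ := by
    intro w b h
    rcases (norm_nonneg (b - a)).eq_or_lt with h0 | h0
    · rw [← h0]; exact norm_nonneg w
    · have := h.trans (real_inner_le_norm _ _)
      rw [sq] at this
      exact le_of_mul_le_mul_left this h0
  have hsub : ∀ w, (({b ∈ S | ‖b - a‖ ^ 2 < inner ℝ (b - a) w} : Finset _) :
      Set (EuclideanSpace ℝ (Fin d))) ⊆ A ∩ Metric.ball (a + (1 / 2 : ℝ) • w) (‖w‖ / 2) := by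
    intro w b hb
    obtain ⟨h1, h2⟩ := mem_filter.1 (mem_coe.1 hb)
    exact ⟨((hS b).1 h1).1.1, mem_ball_iff_lt_inner.2 h2⟩
  have heq : ∀ w, ‖w‖ ≤ M → (({b ∈ S | ‖b - a‖ ^ 2 < inner ℝ (b - a) w} : Finset _) :
      Set (EuclideanSpace ℝ (Fin d))) = A ∩ Metric.ball (a + (1 / 2 : ℝ) • w) (‖w‖ / 2) := by
    intro w hw
    refine (hsub w).antisymm fun b hb => ?_
    have h1 := mem_ball_iff_lt_inner.1 hb.2
    refine mem_coe.2 (mem_filter.2 ⟨(hS b).2 ⟨⟨hb.1, (hle_of w b h1.le).trans hw⟩, ?_⟩, h1⟩)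
    rintro rfl
    simp at h1
  constructor
  · rintro ⟨hsA, hcard, -, z, r, hr, hsph, hball⟩
    rw [card_insert_of_notMem haB, add_left_inj] at hcard
    rw [coe_insert] at hsA hsph
    obtain ⟨w, rfl⟩ : ∃ w, z = a + (1 / 2 : ℝ) • w := ⟨(2 : ℝ) • (z - a), by
      rw [smul_smul]; norm_num⟩
    obtain rfl : r = ‖w‖ / 2 := by
      have := hsph (Set.mem_insert a _)
      rw [mem_sphere_iff_norm, sub_add_cancel_left, norm_neg, norm_smul] at this
      rw [← this]; norm_num; ring
    have hwM : ‖w‖ ≤ M := by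
      by_contra hlt
      have h1 := hM w (not_le.1 hlt)
      have h2 := Set.encard_le_encard (hsub w)
      rw [hball, Set.encard_coe_eq_coe_finsetCard] at h2
      exact h1.not_ge (by exact_mod_cast h2)
    have hin : ∀ b ∈ B, inner ℝ (b - a) w = ‖b - a‖ ^ 2 := fun b hb =>
      mem_sphere_iff_inner_eq.1 (hsph (Or.inr hb))
    refine ⟨⟨fun b hb => (hS b).2 ⟨⟨hsA (Or.inr hb), (hle_of w b (hin b hb).ge).trans hwM⟩,
      by rintro rfl; exact haB hb⟩, hcard⟩, w, hin, ?_⟩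
    rw [← heq w hwM, Set.encard_coe_eq_coe_finsetCard] at hball
    exact_mod_cast hball
  · rintro ⟨⟨hBS, hcard⟩, w, hin, hk⟩
    have hwM : ‖w‖ ≤ M := by
      by_contra hlt
      exact (hM w (not_le.1 hlt)).ne' hk
    have hw0 : 0 < ‖w‖ := by
      obtain ⟨b, hb⟩ := card_pos.1 (by omega : 0 < #B)
      have hba : 0 < ‖b - a‖ := norm_pos_iff.2 (sub_ne_zero.2 ((hS b).1 (hBS hb)).2)
      exact hba.trans_le (hle_of w b (hin b hb).ge)
    refine ⟨?_, by rw [card_insert_of_notMem haB, hcard], ?_, a + (1 / 2 : ℝ) • w, ‖w‖ / 2,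
      by positivity, ?_, ?_⟩
    · rw [coe_insert]
      exact Set.insert_subset ha fun b hb => ((hS b).1 (hBS hb)).1.1
    · have h1 := (hli B hBS hcard.le).id_image
      have h2 : ((insert a B : Finset (EuclideanSpace ℝ (Fin d))) : Set _) \ {a} =
          (B : Set (EuclideanSpace ℝ (Fin d))) := by
        rw [coe_insert, Set.insert_sdiff_of_mem _ (Set.mem_singleton a),
          Set.sdiff_singleton_eq_self (by simpa using haB)]
      refine (affineIndependent_set_iff_linearIndependent_vsub ℝ (p₁ := a)
        (s := ((insert a B : Finset (EuclideanSpace ℝ (Fin d))) : Set _)) (by simp)).2 ?_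
      rw [h2]
      exact h1
    · rw [coe_insert]
      refine Set.insert_subset ?_ fun b hb => mem_sphere_iff_inner_eq.2 (hin b hb)
      rw [mem_sphere_iff_inner_eq]; simp
    · rw [← heq w hwM, Set.encard_coe_eq_coe_finsetCard, hk]

theorem ae_sub_notMem_span (S : Finset (EuclideanSpace ℝ (Fin d)))
    (a : EuclideanSpace ℝ (Fin d)) :
    ∀ᵐ y : EuclideanSpace ℝ (Fin d), ∀ T ⊆ S, T.card < d →
      y - a ∉ Submodule.span ℝ ((fun b => b - a) '' (T : Set (EuclideanSpace ℝ (Fin d)))) := by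
  simp only [← Finset.mem_powerset]
  rw [Filter.eventually_all_finset]
  intro T _
  by_cases hT : T.card < d
  · simp only [hT, forall_const]
    set V := Submodule.span ℝ ((fun b => b - a) '' (T : Set (EuclideanSpace ℝ (Fin d))))
    have h0 := Measure.addHaar_affineSubspace volume (AffineSubspace.mk' a V) (fun h => by
      have h1 := congrArg AffineSubspace.direction h
      rw [AffineSubspace.direction_mk', AffineSubspace.direction_top] at h1
      exact span_sub_ne_top hT h1)
    refine measure_mono_null (fun y hy => ?_) h0
    simpa [AffineSubspace.mem_mk'] using hy
  · simp [hT]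

end HeftySimplices

/-! ### From almost every point to every point -/

section Covering

variable {d : ℕ} {F : Set (Finset (EuclideanSpace ℝ (Fin d)))}
  {G U : Set (EuclideanSpace ℝ (Fin d))} {N : ℕ}

theorem isClosed_convexHull_finset (s : Finset (EuclideanSpace ℝ (Fin d))) :
    IsClosed (convexHull ℝ (s : Set (EuclideanSpace ℝ (Fin d)))) :=
  s.finite_toSet.isCompact_convexHull (𝕜 := ℝ) |>.isClosed

/-- The cover number of a finite family is locally constant off the boundaries, so a value
taken on a dense set is taken there. -/
theorem coverNumber_eq_of_not_onBoundaryOf (hF : F.Finite) (hG : Dense G) (hU : IsOpen U)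
    (hN : ∀ y ∈ U ∩ G, coverNumber F y = N) {y : EuclideanSpace ℝ (Fin d)} (hy : y ∈ U)
    (hb : ¬ OnBoundaryOf F y) : coverNumber F y = N := by
  have hev : ∀ᶠ y' in nhds y, ∀ s ∈ F,
      (y' ∈ convexHull ℝ (s : Set (EuclideanSpace ℝ (Fin d))) ↔
        y ∈ convexHull ℝ (s : Set (EuclideanSpace ℝ (Fin d)))) := by
    rw [Filter.eventually_all_finite hF]
    intro s hs
    by_cases hys : y ∈ convexHull ℝ (s : Set (EuclideanSpace ℝ (Fin d)))
    · have hint : y ∈ interior (convexHull ℝ (s : Set (EuclideanSpace ℝ (Fin d)))) := by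
        by_contra hni
        exact hb ⟨s, hs, subset_closure hys, hni⟩
      filter_upwards [mem_interior_iff_mem_nhds.1 hint] with y' hy'
      exact iff_of_true hy' hys
    · filter_upwards [(isClosed_convexHull_finset s).isOpen_compl.mem_nhds hys] with y' hy'
      exact iff_of_false hy' hys
  obtain ⟨y', ⟨h1, h2⟩, h3⟩ := mem_closure_iff_nhds.1 (hG y) _ (hev.and (hU.mem_nhds hy))
  rw [← hN y' ⟨h2, h3⟩, coverNumber, coverNumber]
  congr 1
  ext s
  exact and_congr_right fun hs => (h1 s hs).symm

/-- Let `y` be on the boundary of a member `s₀`. Near `y`, outside `s₀`, there is a point of the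
dense set; the members covering it are closed, hence also contain `y`, and `s₀` is an additional
one. -/
theorem lt_coverNumber_of_onBoundaryOf (hF : F.Finite) (hG : Dense G) (hU : IsOpen U)
    (hN : ∀ y ∈ U ∩ G, coverNumber F y = N) {y : EuclideanSpace ℝ (Fin d)} (hy : y ∈ U)
    (hb : OnBoundaryOf F y) : N < coverNumber F y := by
  obtain ⟨s₀, hs₀, hys₀⟩ := hb
  have hev : ∀ᶠ y' in nhds y, ∀ s ∈ F,
      (y' ∈ convexHull ℝ (s : Set (EuclideanSpace ℝ (Fin d))) →
        y ∈ convexHull ℝ (s : Set (EuclideanSpace ℝ (Fin d)))) := by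
    rw [Filter.eventually_all_finite hF]
    intro s hs
    by_cases hys : y ∈ convexHull ℝ (s : Set (EuclideanSpace ℝ (Fin d)))
    · exact Filter.Eventually.of_forall fun _ _ => hys
    · filter_upwards [(isClosed_convexHull_finset s).isOpen_compl.mem_nhds hys] with y' hy' h
      exact absurd h hy'
  have hcl : y ∈ closure (convexHull ℝ (s₀ : Set (EuclideanSpace ℝ (Fin d))))ᶜ := by
    rw [closure_compl]; exact hys₀.2
  obtain ⟨y₁, ⟨h1, h2⟩, h3⟩ := mem_closure_iff_nhds.1 hcl _
    (hev.eventually_nhds.and (hU.mem_nhds hy))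
  obtain ⟨y', ⟨⟨h4, h5⟩, h6⟩, h7⟩ := mem_closure_iff_nhds.1 (hG y₁) _
    ((h1.and (hU.mem_nhds h2)).and ((isClosed_convexHull_finset s₀).isOpen_compl.mem_nhds h3))
  rw [← hN y' ⟨h5, h7⟩]
  refine Set.Finite.encard_lt_encard (hF.subset fun s hs => hs.1) ?_
  rw [Set.ssubset_iff_exists]
  exact ⟨fun s hs => ⟨hs.1, h4 s hs.1 hs.2⟩, s₀,
    ⟨hs₀, (isClosed_convexHull_finset s₀).closure_eq ▸ hys₀.1⟩, fun h => h6 h.2⟩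

end Covering

theorem theorem2p3 (d : ℕ) (hd : 1 ≤ d) (k : ℕ) (A : Set (EuclideanSpace ℝ (Fin d)))
    (hA : IsThinDelone A) (hgen : IsGenericSet A)
    (a : EuclideanSpace ℝ (Fin d)) (ha : a ∈ A) :
    ∃ ε : ℝ, 0 < ε ∧
      (∀ y ∈ Metric.ball a ε, IsGenericWrt A y →
        coverNumber (heftySimplicesAt k A a) y = ((d + k - 1).choose (d - 1) : ℕ)) ∧
      (∀ᵐ y ∂(volume.restrict (Metric.ball a ε)),
        coverNumber (heftySimplicesAt k A a) y = ((d + k - 1).choose (d - 1) : ℕ)) ∧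
      (∀ y ∈ Metric.ball a ε, ¬ OnBoundaryOf (heftySimplicesAt k A a) y →
        coverNumber (heftySimplicesAt k A a) y = ((d + k - 1).choose (d - 1) : ℕ)) ∧
      (∀ y ∈ Metric.ball a ε, OnBoundaryOf (heftySimplicesAt k A a) y →
        ((d + k - 1).choose (d - 1) : ℕ) < coverNumber (heftySimplicesAt k A a) y) := by
  classical
  have hinf : A.Infinite := hA.2.infinite hd
  obtain ⟨M, hM⟩ := hA.2.exists_forall_le_encard a (k + 1)
  let S : Finset (EuclideanSpace ℝ (Fin d)) := (hA.1 a M).toFinset.erase a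
  have hS : ∀ b, b ∈ S ↔ (b ∈ A ∧ ‖b - a‖ ≤ M) ∧ b ≠ a := by
    intro b
    simp only [S, Finset.mem_erase, Set.Finite.mem_toFinset, Set.mem_inter_iff,
      mem_closedBall_iff_norm]
    tauto
  have hSA : ∀ T ⊆ S, (T : Set (EuclideanSpace ℝ (Fin d))) ⊆ A \ {a} := fun T hT b hb =>
    ⟨((hS b).1 (hT hb)).1.1, ((hS b).1 (hT hb)).2⟩
  have hMS : ∀ w, M < ‖w‖ → k < Finset.card {b ∈ S | ‖b - a‖ ^ 2 < inner ℝ (b - a) w} := by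
    intro w hw
    have h1 := hM w hw
    have h2 : {b ∈ A | ‖b - a‖ ≤ M ∧ ‖b - a‖ ^ 2 < inner ℝ (b - a) w} ⊆
        (({b ∈ S | ‖b - a‖ ^ 2 < inner ℝ (b - a) w} : Finset _) : Set _) := by
      rintro b ⟨hbA, hbM, hb⟩
      refine Finset.mem_coe.2 (Finset.mem_filter.2 ⟨(hS b).2 ⟨⟨hbA, hbM⟩, ?_⟩, hb⟩)
      rintro rfl
      simp at hb
    have h3 := h1.trans (Set.encard_le_encard h2)
    rw [Set.encard_coe_eq_coe_finsetCard] at h3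
    exact Nat.succ_le_iff.1 (by exact_mod_cast h3)
  have hli : ∀ T ⊆ S, T.card ≤ d →
      LinearIndepOn ℝ (fun b => b - a) (T : Set (EuclideanSpace ℝ (Fin d))) :=
    fun T hT hc => hgen.linearIndepOn_sub hinf ha (hSA T hT) hc
  have hhefty {B : Finset (EuclideanSpace ℝ (Fin d))} (haB : a ∉ B) :=
    isHeftySimplex_insert_iff hd ha hS hMS hli haB
  have haS : ∀ B ⊆ S, a ∉ B := fun B hB h => ((hS a).1 (hB h)).2 rfl
  set F := heftySimplicesAt k A a
  have hF : F.Finite := by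
    refine ((S.powersetCard d).finite_toSet.image (insert a)).subset ?_
    rintro s ⟨hs, has⟩
    rw [← Finset.insert_erase has] at hs
    exact ⟨s.erase a,
      Finset.mem_coe.2 (Finset.mem_powersetCard.2 ((hhefty (Finset.notMem_erase a s)).1 hs).1),
      Finset.insert_erase has⟩
  -- near `a`, lying in a simplex with vertex `a` amounts to lying in its cone at `a`
  have hcone : ∀ᶠ y in nhds a, ∀ B ∈ S.powersetCard d,
      (y ∈ convexHull ℝ ((insert a B : Finset _) : Set (EuclideanSpace ℝ (Fin d))) ↔
        ∃ c : EuclideanSpace ℝ (Fin d) → ℝ, (∀ b ∈ B, 0 ≤ c b) ∧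
          ∑ b ∈ B, c b • (b - a) = y - a) := by
    rw [Filter.eventually_all_finset]
    intro B hB
    obtain ⟨h1, h2⟩ := Finset.mem_powersetCard.1 hB
    exact eventually_mem_convexHull_insert_iff (haS B h1) (hli B h1 h2.le)
  obtain ⟨ε, hε, hball⟩ := Metric.eventually_nhds_iff_ball.1 hcone
  let G : Set (EuclideanSpace ℝ (Fin d)) := {y | ∀ T ⊆ S, T.card < d →
    y - a ∉ Submodule.span ℝ ((fun b => b - a) '' (T : Set (EuclideanSpace ℝ (Fin d))))}
  have hGae : ∀ᵐ y, y ∈ G := ae_sub_notMem_span S a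
  have hcount : ∀ y ∈ Metric.ball a ε ∩ G,
      coverNumber F y = ((d + k - 1).choose (d - 1) : ℕ) := by
    rintro y ⟨hy, hyG⟩
    rw [← card_optimalBases_with_violations (K := k) hd finrank_euclideanSpace_fin
      (S := S) (p := fun b => b - a) (h := fun b => ‖b - a‖ ^ 2)
      (fun b hb => pow_pos (norm_pos_iff.2 (sub_ne_zero.2 ((hS b).1 hb).2)) 2) hli
      (fun w => hgen.card_tight_le ha (hSA _ (Finset.filter_subset _ _))
        fun b hb => (Finset.mem_filter.1 hb).2) hMS (v := y - a) hyG, coverNumber]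
    have hinj : Set.InjOn (insert a) {B : Finset (EuclideanSpace ℝ (Fin d)) | B ⊆ S} := by
      intro B₁ h1 B₂ h2 h
      rw [← Finset.erase_insert (haS B₁ h1), ← Finset.erase_insert (haS B₂ h2)]
      exact congrArg (fun s => s.erase a) h
    refine Eq.trans (congrArg Set.encard ?_)
      (Set.InjOn.encard_image (hinj.mono fun B hB => hB.1.1))
    ext s
    constructor
    · rintro ⟨⟨hs, has⟩, hys⟩
      rw [← Finset.insert_erase has] at hs hys
      obtain ⟨h1, h2⟩ := (hhefty (Finset.notMem_erase a s)).1 hs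
      exact ⟨s.erase a, ⟨h1, (hball y hy _ (Finset.mem_powersetCard.2 h1)).1 hys, h2⟩,
        Finset.insert_erase has⟩
    · rintro ⟨B, ⟨h1, h2, h3⟩, rfl⟩
      exact ⟨⟨(hhefty (haS B h1.1)).2 ⟨h1, h3⟩, Finset.mem_insert_self a B⟩,
        (hball y hy _ (Finset.mem_powersetCard.2 h1)).2 h2⟩
  have hGd : Dense G := Measure.dense_of_ae hGae
  refine ⟨ε, hε, fun y hy hyg => ?_, ?_, fun y hy => ?_, fun y hy => ?_⟩
  · exact hcount y ⟨hy, fun T hT hc => hyg.sub_notMem_span hinf ha (hSA T hT) hc⟩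
  · filter_upwards [ae_restrict_of_ae hGae, ae_restrict_mem measurableSet_ball] with y h1 h2
    exact hcount y ⟨h2, h1⟩
  · exact coverNumber_eq_of_not_onBoundaryOf hF hGd Metric.isOpen_ball hcount hy
  · exact lt_coverNumber_of_onBoundaryOf hF hGd Metric.isOpen_ball hcount hy
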